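/- Let $\Gamma$ be a countable discrete group equipped with a proper length function $\ell\colon\Gamma\to\{0,1,2,\dots\}$, i.e. $\ell(\gamma)=0$ iff $\gamma=1$, $\ell(\gamma^{-1})=\ell(\gamma)$, $\ell(\gamma_1\gamma_2)\le\ell(\gamma_1)+\ell(\gamma_2)$, and each ball $B_k=\{\gamma\in\Gamma : \ell(\gamma)\le k\}$ is finite. Let $\Gamma\curvearrowright(X,\nu)$ be a measurable, measure-preserving, ergodic action on a $\sigma$-finite measure space. Then the action is strongly ergodic if and only if there is a measurable set $Y\subseteq X$ with $0<\nu(Y)<\infty$ such that the action has local spectral gap with respect to $Y$. Here the terms have the following meaning. * The action has *local spectral gap* with respect to $Y$ if there exist $\kappa>0$ and $k\in\mathbb N$ such that $$\|f\|_{Y,2}\le\kappa\sum_{\gamma\in B_k}\|\gamma\cdot f-f\|_{Y,2}$$ for every $f\in L^2(X,\nu)$ with $\int_Y f\,d\nu=0$, where $(\gamma\cdot f)(x)=f(\gamma^{-1}x)$ and $\|f\|_{Y,2}=\big(\int_Y|f|^2\,d\nu\big)^{1/2}$. (The scalars may be real or complex; the result holds in both cases.) * The action is *strongly ergodic* with respect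 to a probability measure $\nu'$ if every sequence $(C_n)_{n\in\mathbb N}$ of measurable subsets of $X$ with $\lim_{n}\nu'(C_n\mathbin{\triangle}\gamma C_n)=0$ for every $\gamma\in\Gamma$ satisfies $\lim_{n}\nu'(C_n)\,(1-\nu'(C_n))=0$. It is *strongly ergodic* with respect to the $\sigma$-finite measure $\nu$ if it is strongly ergodic with respect to some probability measure $\nu'$ equivalent to $\nu$ (that is, having the same null sets). -/

import Mathlib

open MeasureTheory Filter Topology
open scoped Pointwise symmDiff ENNReal

/-- A proper length function on a group `Γ`, with values in `ℕ`. -/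
structure ProperLength (Γ : Type*) [Group Γ] where
  /-- the length of an element -/
  length : Γ → ℕ
  length_eq_zero_iff : ∀ γ, length γ = 0 ↔ γ = 1
  length_inv : ∀ γ, length γ⁻¹ = length γ
  length_mul_le : ∀ γ₁ γ₂, length (γ₁ * γ₂) ≤ length γ₁ + length γ₂
  /-- properness: bounded sets are finite -/
  finite_ball : ∀ k : ℕ, {γ | length γ ≤ k}.Finite

/-- The closed ball `B_k = {γ | ℓ γ ≤ k}`, as a finite set. -/
noncomputable def ProperLength.ball {Γ : Type*} [Group Γ] (ℓ : ProperLength Γ) (k : ℕ) :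
    Finset Γ :=
  (ℓ.finite_ball k).toFinset

/-- The norm `‖f‖_{Y,2} = (∫_Y |f|² dν)^{1/2}`, with values in `[0, ∞]`. -/
noncomputable def localNorm {X : Type*} [MeasurableSpace X] {𝕜 : Type*} [RCLike 𝕜]
    (ν : Measure X) (Y : Set X) (f : X → 𝕜) : ℝ≥0∞ :=
  eLpNorm f 2 (ν.restrict Y)

/-- The action of `Γ` on `(X, ν)` has local spectral gap with respect to `Y`: there are `κ > 0`
and `k ∈ ℕ` with `‖f‖_{Y,2} ≤ κ ∑_{γ ∈ B_k} ‖γ·f - f‖_{Y,2}` for all `f ∈ L²(X, ν; 𝕜)` with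
`∫_Y f dν = 0`, where `(γ·f)(x) = f (γ⁻¹ x)`. -/
def HasLocalSpectralGap (𝕜 : Type*) [RCLike 𝕜] {Γ X : Type*} [Group Γ] [MulAction Γ X]
    [MeasurableSpace X] (ℓ : ProperLength Γ) (ν : Measure X) (Y : Set X) : Prop :=
  ∃ κ : ℝ, 0 < κ ∧ ∃ k : ℕ, ∀ f : X → 𝕜, MemLp f 2 ν → ∫ x in Y, f x ∂ν = 0 →
    localNorm ν Y f ≤
      ENNReal.ofReal κ * ∑ γ ∈ ℓ.ball k, localNorm ν Y (fun x => f (γ⁻¹ • x) - f x)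

/-- Strong ergodicity with respect to a probability measure `μ`: asymptotically invariant
sequences of measurable sets are asymptotically trivial. -/
def IsStronglyErgodicProb (Γ : Type*) {X : Type*} [Group Γ] [MulAction Γ X]
    [MeasurableSpace X] (μ : Measure X) : Prop :=
  ∀ C : ℕ → Set X, (∀ n, MeasurableSet (C n)) →
    (∀ γ : Γ, Tendsto (fun n => μ (C n ∆ (γ • C n))) atTop (𝓝 0)) →
    Tendsto (fun n => μ (C n) * (1 - μ (C n))) atTop (𝓝 0)

/-- Strong ergodicity with respect to a `σ`-finite measure `ν`: strong ergodicity with respect to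
some probability measure `ν'` equivalent to `ν`. -/
def IsStronglyErgodic (Γ : Type*) {X : Type*} [Group Γ] [MulAction Γ X]
    [MeasurableSpace X] (ν : Measure X) : Prop :=
  ∃ ν' : Measure X, IsProbabilityMeasure ν' ∧ ν' ≪ ν ∧ ν ≪ ν' ∧ IsStronglyErgodicProb Γ ν'

/-! Gap to strong ergodicity. Let `C n` be asymptotically invariant, and let `D n` be whichever of
`C n` and its complement fills at most half of `Y`. The gap, tested on the indicator of `D n` minus
its mean over `Y`, forces `ν (D n ∩ Y)` to zero. Almost invariance carries this to every translate
`γ • Y`, and by ergodicity the translates cover `X` up to a null set.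

Strong ergodicity to gap. On any `Y₀` of finite positive measure, subsets of intermediate size must
have boundary at least some `δ` under some ball (`IsStronglyErgodic.exists_expansion`). Otherwise
there are sets `A j ⊆ Y₀` with boundary tending to zero under growing balls; the unions of `γ • A j`
over `B_j` are then asymptotically invariant yet nontrivial. This says nothing about small sets,
which may have relatively tiny boundary. A maximal set `F` with small relative boundary is therefore
removed (`exists_subset_expansion`). On `Y = Y₀ \ F` the boundary of every set filling at most half
of `Y` is at least proportional to its measure. Cheeger's argument (`cheeger`) turns this
isoperimetric inequality into the `L²` estimate: integrate over the level sets of `g ^ 2`, apply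
Cauchy–Schwarz, and reduce to functions supported on half of `Y` by subtracting a median. -/

/-! ### Absolute continuity along sequences of sets -/

/-- A finite measure that is absolutely continuous w.r.t. `ρ` is uniformly so. -/
theorem tendsto_measure_zero_of_absolutelyContinuous {X : Type*} [MeasurableSpace X]
    {μ ρ : Measure X} [IsFiniteMeasure μ] [IsFiniteMeasure ρ] (h : μ ≪ ρ) {s : ℕ → Set X}
    (hs : Tendsto (fun n => ρ (s n)) atTop (𝓝 0)) : Tendsto (fun n => μ (s n)) atTop (𝓝 0) := by
  have h1 : ∫⁻ x, μ.rnDeriv ρ x ∂ρ ≠ ∞ := (Measure.lintegral_rnDeriv_lt_top μ ρ).ne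
  refine (tendsto_setLIntegral_zero h1 hs).congr fun n => ?_
  rw [← withDensity_apply' _ (s n), Measure.withDensity_rnDeriv_eq μ ρ h]

theorem tendsto_measure_inter_zero_of_absolutelyContinuous {X : Type*} [MeasurableSpace X]
    {μ ρ : Measure X} [IsFiniteMeasure ρ] (h : μ ≪ ρ) {T : Set X} (hT : MeasurableSet T)
    (hμT : μ T ≠ ∞) {s : ℕ → Set X} (hs : Tendsto (fun n => ρ (s n)) atTop (𝓝 0)) :
    Tendsto (fun n => μ (s n ∩ T)) atTop (𝓝 0) := by
  have : IsFiniteMeasure (μ.restrict T) := isFiniteMeasure_restrict.2 hμT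
  refine (tendsto_measure_zero_of_absolutelyContinuous
    (Measure.restrict_le_self.absolutelyContinuous.trans h : μ.restrict T ≪ ρ) hs).congr
      fun n => ?_
  rw [Measure.restrict_apply' hT]

/-! ### Translates of a set of positive measure -/

section Action

variable {Γ X : Type*} [Group Γ] [MeasurableSpace X] [MulAction Γ X] [MeasurableConstSMul Γ X]

/-- The union is invariant and contains `Y`, so ergodicity leaves only the conull alternative. -/
theorem measure_compl_iUnion_smul [Countable Γ] {ν : Measure X} [ErgodicSMul Γ X ν] {Y : Set X}
    (hY : MeasurableSet Y) (h0 : ν Y ≠ 0) : ν (⋃ γ : Γ, γ • Y)ᶜ = 0 := by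
  have hm : MeasurableSet (⋃ γ : Γ, γ • Y) := .iUnion fun γ => hY.const_smul γ
  have hinv : ∀ g : Γ, g • (⋃ γ : Γ, γ • Y) = ⋃ γ : Γ, γ • Y := fun g => by
    rw [Set.smul_set_iUnion]
    simp_rw [smul_smul]
    exact (Equiv.mulLeft g).surjective.iUnion_comp (fun γ => γ • Y)
  have hc : EventuallyConst (⋃ γ : Γ, γ • Y) (ae ν) :=
    aeconst_of_forall_smul_ae_eq Γ hm.nullMeasurableSet fun g => (hinv g).eventuallyEq
  rcases eventuallyConst_set'.1 hc with h | h
  · exact absurd (measure_mono_null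
      (by simpa using Set.subset_iUnion (fun γ : Γ => γ • Y) 1) (ae_eq_empty.1 h)) h0
  · exact ae_eq_univ.1 h

/-- A sequence of sets which is small on each translate of `Y` is small. -/
theorem tendsto_measure_zero_of_inter_smul [Countable Γ] {ν ν' : Measure X} [IsFiniteMeasure ν']
    [ErgodicSMul Γ X ν] (hac : ν' ≪ ν) {Y : Set X} (hY : MeasurableSet Y) (h0 : ν Y ≠ 0)
    (htop : ν Y ≠ ∞) {C : ℕ → Set X} (hC : ∀ n, MeasurableSet (C n))
    (h : ∀ γ : Γ, Tendsto (fun n => ν (C n ∩ γ • Y)) atTop (𝓝 0)) :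
    Tendsto (fun n => ν' (C n)) atTop (𝓝 0) := by
  have h1 : ∀ γ : Γ, Tendsto (fun n => ν' (C n ∩ γ • Y)) atTop (𝓝 0) := fun γ => by
    have : IsFiniteMeasure (ν.restrict (γ • Y)) :=
      isFiniteMeasure_restrict.2 (by rwa [measure_smul])
    simp_rw [← Measure.restrict_apply (hC _)] at h ⊢
    exact tendsto_measure_zero_of_absolutelyContinuous (hac.restrict (γ • Y)) (h γ)
  obtain ⟨e, he⟩ := exists_surjective_nat Γ
  -- These complements decrease to the complement of all translates, which is null, so finitely many
  -- translates suffice up to `ε / 2`.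
  have h2 : Tendsto (fun m => ν' (Set.accumulate (fun i => e i • Y) m)ᶜ) atTop (𝓝 0) := by
    have hU : (⋂ m, (Set.accumulate (fun i => e i • Y) m)ᶜ) = (⋃ γ : Γ, γ • Y)ᶜ := by
      rw [← Set.compl_iUnion, Set.iUnion_accumulate, he.iUnion_comp (fun γ => γ • Y)]
    have := tendsto_measure_iInter_atTop (μ := ν')
      (s := fun m => (Set.accumulate (fun i => e i • Y) m)ᶜ)
      (fun m => (MeasurableSet.biUnion (Set.to_countable _)
        fun i _ => hY.const_smul (e i)).compl.nullMeasurableSet)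
      (fun a b hab => Set.compl_subset_compl.2 (Set.monotone_accumulate hab)) ⟨0, measure_ne_top _ _⟩
    rwa [hU, hac (measure_compl_iUnion_smul hY h0)] at this
  refine ENNReal.tendsto_nhds_zero.2 fun ε hε => ?_
  obtain ⟨m, hm⟩ := (ENNReal.tendsto_nhds_zero.1 h2 (ε / 2) (ENNReal.half_pos hε.ne')).exists
  have h3 : Tendsto (fun n => ∑ i ∈ Finset.Iic m, ν' (C n ∩ e i • Y)) atTop (𝓝 0) := by
    simpa using tendsto_finsetSum (Finset.Iic m) fun i _ => h1 (e i)
  filter_upwards [ENNReal.tendsto_nhds_zero.1 h3 (ε / 2) (ENNReal.half_pos hε.ne')] with n hn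
  calc ν' (C n) ≤ ν' ((⋃ i ∈ Finset.Iic m, (C n ∩ e i • Y)) ∪
        (Set.accumulate (fun i => e i • Y) m)ᶜ) := measure_mono fun x hx => by
          by_cases hx' : x ∈ Set.accumulate (fun i => e i • Y) m
          · obtain ⟨i, hi, hxi⟩ := Set.mem_accumulate.1 hx'
            exact Or.inl (Set.mem_biUnion (by simpa using hi) ⟨hx, hxi⟩)
          · exact Or.inr hx'
    _ ≤ ε / 2 + ε / 2 := (measure_union_le _ _).trans
        (add_le_add ((measure_biUnion_finset_le _ _).trans hn) hm)
    _ = ε := ENNReal.add_halves ε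

end Action

/-! ### From strong ergodicity to expansion of sets of intermediate size -/

theorem compl_symmDiff_smul_compl {Γ X : Type*} [Group Γ] [MulAction Γ X] (γ : Γ) (C : Set X) :
    Cᶜ ∆ (γ • Cᶜ) = C ∆ (γ • C) := by
  rw [Set.smul_set_compl, compl_symmDiff_compl]

theorem ProperLength.mem_ball {Γ : Type*} [Group Γ] {ℓ : ProperLength Γ} {k : ℕ} {γ : Γ} :
    γ ∈ ℓ.ball k ↔ ℓ.length γ ≤ k := by
  simp [ProperLength.ball]

theorem one_sub_measure_eq {X : Type*} [MeasurableSpace X] {μ : Measure X}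
    [IsProbabilityMeasure μ] {C : Set X} (hC : MeasurableSet C) : 1 - μ C = μ Cᶜ :=
  (prob_compl_eq_one_sub hC).symm

/-- The union of the translates `γ • A`, `γ ∈ B_j`, is close to `g • A` on `g • Y`
if `A ⊆ Y` is almost invariant inside `Y`. -/
theorem measure_symmDiff_biUnion_ball_inter_smul_le {Γ X : Type*} [Group Γ] [MeasurableSpace X]
    [MulAction Γ X] [MeasurableConstSMul Γ X] (ℓ : ProperLength Γ) {ν : Measure X}
    [SMulInvariantMeasure Γ X ν] {Y A : Set X} {j : ℕ} {g : Γ} (hg : ℓ.length g ≤ j) :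
    ν (((⋃ γ ∈ ℓ.ball j, γ • A) ∆ (g • A)) ∩ g • Y) ≤
      ∑ γ ∈ ℓ.ball (2 * j), ν ((γ • A ∩ Y) \ A) := by
  -- Translating by `g⁻¹` moves the comparison into `Y`: the pieces become `g⁻¹γ • A` with `g⁻¹γ ∈
  -- B_{2j}`.
  rw [← measure_smul ν g⁻¹]
  refine (measure_mono fun x hx => ?_).trans (measure_biUnion_finset_le (ℓ.ball (2 * j)) _)
  rw [Set.mem_smul_set_iff_inv_smul_mem, inv_inv] at hx
  obtain ⟨h1, h2⟩ := hx
  rw [Set.smul_mem_smul_set_iff] at h2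
  rcases h1 with ⟨h1, h3⟩ | ⟨h1, h3⟩
  · rw [Set.smul_mem_smul_set_iff] at h3
    simp only [Set.mem_iUnion, exists_prop] at h1 ⊢
    obtain ⟨γ, hγ, hx⟩ := h1
    refine ⟨g⁻¹ * γ, ?_, ⟨?_, h2⟩, h3⟩
    · rw [ProperLength.mem_ball] at hγ ⊢
      have := ℓ.length_mul_le g⁻¹ γ
      rw [ℓ.length_inv] at this
      omega
    · rw [mul_smul, Set.mem_smul_set_iff_inv_smul_mem, inv_inv]
      exact hx
  · exact absurd (Set.mem_biUnion (t := fun γ : Γ => γ • A)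
      (ProperLength.mem_ball.2 hg : g ∈ (ℓ.ball j : Set Γ)) h1) h3

/-- Strong ergodicity implies asymptotic expansion on sets of finite measure. -/
theorem IsStronglyErgodic.exists_expansion {Γ X : Type*} [Group Γ] [Countable Γ]
    (ℓ : ProperLength Γ) [MeasurableSpace X] [MulAction Γ X] [MeasurableConstSMul Γ X]
    {ν : Measure X} [ErgodicSMul Γ X ν] (h : IsStronglyErgodic Γ ν) {Y : Set X}
    (hY : MeasurableSet Y) (h0 : ν Y ≠ 0) (htop : ν Y ≠ ∞) {α : ℝ≥0∞} (hα : α ≠ 0) :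
    ∃ k : ℕ, ∃ δ : ℝ≥0∞, δ ≠ 0 ∧ ∀ A ⊆ Y, MeasurableSet A → α ≤ ν A → α ≤ ν (Y \ A) →
      δ ≤ ∑ γ ∈ ℓ.ball k, ν ((γ • A ∩ Y) \ A) := by
  classical
  obtain ⟨ν', _, hν'ν, hνν', hse⟩ := h
  by_contra! hcon
  -- The radius is `2 * j` because the union over `B_j` below is compared with a single translate.
  choose A hAY hAm hA1 hA2 hA3 using fun j : ℕ =>
    hcon (2 * j) ((j : ℝ≥0∞) + 1)⁻¹ (by simp)
  set C : ℕ → Set X := fun j => ⋃ γ ∈ ℓ.ball j, γ • A j with hCdef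
  have hCm : ∀ j, MeasurableSet (C j) := fun j =>
    Finset.measurableSet_biUnion _ fun γ _ => (hAm j).const_smul γ
  have hlim : Tendsto (fun j : ℕ => ((j : ℝ≥0∞) + 1)⁻¹) atTop (𝓝 0) := by
    have := (tendsto_add_atTop_iff_nat 1).2 ENNReal.tendsto_inv_nat_nhds_zero
    simpa using this
  have hclose : ∀ g : Γ, Tendsto (fun j => ν ((C j ∆ (g • A j)) ∩ g • Y)) atTop (𝓝 0) := fun g => by
    refine tendsto_of_tendsto_of_tendsto_of_le_of_le' tendsto_const_nhds hlim
      (Eventually.of_forall fun _ => zero_le) ?_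
    filter_upwards [eventually_ge_atTop (ℓ.length g)] with j hj
    exact (measure_symmDiff_biUnion_ball_inter_smul_le ℓ hj).trans (hA3 j).le
  have hinv : ∀ γ : Γ, Tendsto (fun j => ν' (C j ∆ (γ • C j))) atTop (𝓝 0) := fun γ => by
    refine tendsto_measure_zero_of_inter_smul (Γ := Γ) hν'ν hY h0 htop
      (fun j => (hCm j).symmDiff ((hCm j).const_smul γ)) fun g => ?_
    -- On `g • Y` both `C j` and `γ • C j` are close to `g • A j`; for the latter, translate by `γ`
    -- the closeness of `C j` to `γ⁻¹g • A j`.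
    have hsum := (hclose g).add (hclose (γ⁻¹ * g))
    rw [add_zero] at hsum
    refine tendsto_of_tendsto_of_tendsto_of_le_of_le tendsto_const_nhds hsum
      (fun _ => zero_le) fun j => ?_
    dsimp only
    rw [← measure_smul ν γ ((C j ∆ ((γ⁻¹ * g) • A j)) ∩ (γ⁻¹ * g) • Y)]
    refine (measure_mono ?_).trans (measure_union_le _ _)
    rw [Set.smul_set_inter, Set.smul_set_symmDiff, smul_smul, smul_smul, mul_inv_cancel_left,
      ← Set.union_inter_distrib_right]
    refine Set.inter_subset_inter_left _ ?_
    rw [symmDiff_comm (γ • C j)]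
    exact symmDiff_triangle _ _ _
  have hend := hse C hCm hinv
  -- The `ν'`-smaller of `C j` and its complement; its measure is at most `2 t (1 - t)` with `t = ν'
  -- (C j)`.
  set D : ℕ → Set X := fun j => if ν' (C j) ≤ 1 / 2 then C j else (C j)ᶜ with hDdef
  have hD : Tendsto (fun j => ν' (D j)) atTop (𝓝 0) := by
    have h2 : Tendsto (fun j => 2 * (ν' (C j) * (1 - ν' (C j)))) atTop (𝓝 0) := by
      simpa using ENNReal.Tendsto.const_mul hend (Or.inr (by simp : (2 : ℝ≥0∞) ≠ ∞))
    refine tendsto_of_tendsto_of_tendsto_of_le_of_le tendsto_const_nhds h2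
      (fun _ => zero_le) fun j => ?_
    have h12 : (2 : ℝ≥0∞) * (1 / 2) = 1 := by
      rw [one_div]; exact ENNReal.mul_inv_cancel (by simp) (by simp)
    by_cases hj : ν' (C j) ≤ 1 / 2
    · have h3 : (1 : ℝ≥0∞) / 2 ≤ 1 - ν' (C j) := by
        refine ENNReal.le_sub_of_add_le_left (measure_ne_top _ _) ?_
        calc ν' (C j) + 1 / 2 ≤ 1 / 2 + 1 / 2 := by gcongr
          _ = 1 := ENNReal.add_halves 1
      simp only [hDdef, if_pos hj]
      calc ν' (C j) = 2 * (ν' (C j) * (1 / 2)) := by rw [mul_left_comm, h12, mul_one]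
        _ ≤ _ := by gcongr
    · simp only [hDdef, if_neg hj]
      rw [one_sub_measure_eq (hCm j)]
      calc ν' (C j)ᶜ = 2 * (1 / 2 * ν' (C j)ᶜ) := by rw [← mul_assoc, h12, one_mul]
        _ ≤ _ := by gcongr; exact (not_le.1 hj).le
  have hDY := tendsto_measure_inter_zero_of_absolutelyContinuous hνν' hY htop hD
  have hα2 : 0 < α / 2 := ENNReal.half_pos hα
  have hαtop : α ≠ ∞ := ne_top_of_le_ne_top htop ((hA1 0).trans (measure_mono (hAY 0)))
  obtain ⟨j, hj1, hj2⟩ := ((hDY.eventually_lt_const hα2).and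
    ((hclose 1).eventually_lt_const hα2)).exists
  have hlt : α / 2 < α := ENNReal.half_lt_self hα hαtop
  -- Since `C j` is close to `A j` on `Y`, a small `D j ∩ Y` would make `A j` or `Y \ A j` smaller
  -- than `α`.
  have hle : α ≤ ν (D j ∩ Y) + ν ((C j ∆ ((1 : Γ) • A j)) ∩ (1 : Γ) • Y) := by
    rw [one_smul, one_smul]
    by_cases hj : ν' (C j) ≤ 1 / 2
    · simp only [hDdef, if_pos hj]
      refine (hA1 j).trans ((measure_mono fun x hx => ?_).trans (measure_union_le _ _))
      by_cases hxC : x ∈ C j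
      · exact Or.inl ⟨hxC, hAY j hx⟩
      · exact Or.inr ⟨Or.inr ⟨hx, hxC⟩, hAY j hx⟩
    · simp only [hDdef, if_neg hj]
      refine (hA2 j).trans ((measure_mono fun x hx => ?_).trans (measure_union_le _ _))
      by_cases hxC : x ∈ C j
      · exact Or.inr ⟨Or.inl ⟨hxC, hx.2⟩, hx.1⟩
      · exact Or.inl ⟨hxC, hx.1⟩
  exact absurd hle (not_le.2 ((ENNReal.add_lt_add hj1 hj2).trans_eq (ENNReal.add_halves α)))

/-! ### From local spectral gap to strong ergodicity -/

theorem eLpNorm_two_restrict_indicator_const {X : Type*} [MeasurableSpace X] {E : Type*}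
    [NormedAddCommGroup E] {ν : Measure X} {Y D : Set X} (hD : MeasurableSet D) (c : E) :
    eLpNorm (D.indicator fun _ => c) 2 (ν.restrict Y) = ‖c‖ₑ * ν (D ∩ Y) ^ (1 / 2 : ℝ) := by
  rw [eLpNorm_indicator_const hD (by simp) (by simp), Measure.restrict_apply hD]
  simp

/-- Local spectral gap, tested on (a truncation of) `1_D - c`. -/
theorem measure_inter_rpow_le_of_localSpectralGap (𝕜 : Type*) [RCLike 𝕜] {Γ X : Type*} [Group Γ]
    [MeasurableSpace X] [MulAction Γ X] [MeasurableConstSMul Γ X] {ν : Measure X}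
    [SMulInvariantMeasure Γ X ν] {Y : Set X} (hY : MeasurableSet Y) (h0 : ν Y ≠ 0) (htop : ν Y ≠ ∞)
    {B : Finset Γ} {κ : ℝ≥0∞}
    (h : ∀ f : X → 𝕜, MemLp f 2 ν → ∫ x in Y, f x ∂ν = 0 →
      localNorm ν Y f ≤ κ * ∑ γ ∈ B, localNorm ν Y (fun x => f (γ⁻¹ • x) - f x))
    {D : Set X} (hD : MeasurableSet D) (hDY : ν (D ∩ Y) ≤ ν Y / 2) :
    ν (D ∩ Y) ^ (1 / 2 : ℝ) ≤
      2 * (κ * ∑ γ ∈ B, ν ((D ∆ (γ • D)) ∩ Y) ^ (1 / 2 : ℝ)) := by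
  classical
  -- `ν` may be infinite, so `1_D - c` is cut off outside a set of finite measure. This `W` contains
  -- every point `x` and `γ⁻¹ • x` with `x ∈ Y`, `γ ∈ B`, so the cutoff is invisible in the
  -- inequality.
  set W : Set X := Y ∪ ⋃ γ ∈ B, γ⁻¹ • Y with hW
  have hWm : MeasurableSet W := hY.union (Finset.measurableSet_biUnion _ fun γ _ => hY.const_smul _)
  have hWtop : ν W ≠ ∞ := by
    refine (measure_union_lt_top htop.lt_top
      ((measure_biUnion_finset_le _ _).trans_lt (ENNReal.sum_lt_top.2 fun γ _ => ?_))).ne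
    rw [measure_smul]
    exact htop.lt_top
  -- The mean of `1_D` over `Y`. As `c ≤ 1 / 2`, the test function is at least `1 / 2` on `D ∩ Y`.
  set c : ℝ := ν.real (D ∩ Y) / ν.real Y with hc
  have hYpos : 0 < ν.real Y := ENNReal.toReal_pos h0 htop
  have hc0 : 0 ≤ c := by positivity
  have hc2 : c ≤ 1 / 2 := by
    rw [hc, div_le_iff₀ hYpos]
    have := ENNReal.toReal_mono (ENNReal.div_ne_top htop (by simp)) hDY
    rw [ENNReal.toReal_div] at this
    simp only [Measure.real]
    simpa [div_eq_inv_mul] using this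
  set u : X → 𝕜 := fun x => D.indicator (fun _ => (1 : 𝕜)) x - (c : 𝕜) with hu
  have hum : StronglyMeasurable u :=
    (stronglyMeasurable_const.indicator hD).sub stronglyMeasurable_const
  have hu2 : MemLp u ∞ ν := by
    refine memLp_top_of_bound hum.aestronglyMeasurable (1 + ‖(c : 𝕜)‖) (Eventually.of_forall
      fun x => (norm_sub_le _ _).trans (add_le_add_left ?_ _))
    by_cases hx : x ∈ D <;> simp [hx]
  set f : X → 𝕜 := W.indicator u with hf
  have hfL : MemLp f 2 ν := by
    rw [hf, memLp_indicator_iff_restrict hWm]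
    have : IsFiniteMeasure (ν.restrict W) := isFiniteMeasure_restrict.2 hWtop
    exact (hu2.restrict W).mono_exponent le_top
  have hfY : ∀ x ∈ Y, f x = u x := fun x hx => Set.indicator_of_mem (show x ∈ W from Or.inl hx) _
  have hint : ∫ x in Y, f x ∂ν = 0 := by
    have : IsFiniteMeasure (ν.restrict Y) := isFiniteMeasure_restrict.2 htop
    rw [setIntegral_congr_fun hY hfY, integral_sub ((integrable_const _).indicator hD)
      (integrable_const _), integral_indicator_const _ hD, integral_const]
    simp only [measureReal_restrict_apply hD, measureReal_restrict_apply MeasurableSet.univ,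
      Set.univ_inter, RCLike.real_smul_eq_coe_mul, mul_one]
    rw [← RCLike.ofReal_mul, hc, mul_div_cancel₀ _ hYpos.ne', sub_self]
  have key := h f hfL hint
  have hlow : 2⁻¹ * ν (D ∩ Y) ^ (1 / 2 : ℝ) ≤ localNorm ν Y f := by
    have e1 : ‖(2⁻¹ : ℝ)‖ₑ = 2⁻¹ := by
      rw [Real.enorm_eq_ofReal (by norm_num), ENNReal.ofReal_inv_of_pos (by norm_num)]; simp
    rw [← e1, ← eLpNorm_two_restrict_indicator_const hD]
    refine eLpNorm_mono_ae ((ae_restrict_iff' hY).2 (Eventually.of_forall fun x hx => ?_))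
    rw [hfY x hx]
    by_cases hxD : x ∈ D
    · simp only [hu, Set.indicator_of_mem hxD]
      rw [← RCLike.ofReal_one, ← RCLike.ofReal_sub, RCLike.norm_ofReal, Real.norm_eq_abs,
        abs_of_pos (by norm_num : (0 : ℝ) < 2⁻¹)]
      exact le_trans (by linarith) (le_abs_self _)
    · simp [hxD]
  have hup : ∀ γ ∈ B, localNorm ν Y (fun x => f (γ⁻¹ • x) - f x) =
      ν ((D ∆ (γ • D)) ∩ Y) ^ (1 / 2 : ℝ) := fun γ hγ => by
    have := eLpNorm_two_restrict_indicator_const (ν := ν) (Y := Y)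
      (hD.symmDiff (hD.const_smul γ)) (1 : 𝕜)
    rw [enorm_one, one_mul] at this
    rw [← this]
    refine eLpNorm_congr_norm_ae ((ae_restrict_iff' hY).2 (Eventually.of_forall fun x hx => ?_))
    have hx' : γ⁻¹ • x ∈ W := Or.inr (Set.mem_biUnion (t := fun γ : Γ => γ⁻¹ • Y) hγ
      (Set.smul_mem_smul_set_iff.2 hx))
    rw [hfY x hx, hf, Set.indicator_of_mem hx']
    simp only [hu, sub_sub_sub_cancel_right]
    have hiff : x ∈ γ • D ↔ γ⁻¹ • x ∈ D := Set.mem_smul_set_iff_inv_smul_mem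
    by_cases h1 : x ∈ D <;> by_cases h2 : γ⁻¹ • x ∈ D <;>
      simp [h1, h2, Set.mem_symmDiff, hiff]
  rw [Finset.sum_congr rfl hup] at key
  calc ν (D ∩ Y) ^ (1 / 2 : ℝ) = 2 * (2⁻¹ * ν (D ∩ Y) ^ (1 / 2 : ℝ)) := by
        rw [← mul_assoc, ENNReal.mul_inv_cancel (by simp) (by simp), one_mul]
    _ ≤ _ := mul_le_mul_right (hlow.trans key) 2

theorem tendsto_rpow_half_zero_iff {u : ℕ → ℝ≥0∞} :
    Tendsto (fun n => u n ^ (1 / 2 : ℝ)) atTop (𝓝 0) ↔ Tendsto u atTop (𝓝 0) := by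
  constructor <;> intro h
  · have h2 := h.ennrpow_const (2 : ℝ)
    simp_rw [← ENNReal.rpow_mul] at h2
    norm_num at h2
    exact h2
  · simpa using h.ennrpow_const (1 / 2 : ℝ)

theorem HasLocalSpectralGap.isStronglyErgodic {𝕜 : Type*} [RCLike 𝕜] {Γ X : Type*} [Group Γ]
    [Countable Γ] {ℓ : ProperLength Γ} [MeasurableSpace X] [MulAction Γ X]
    [MeasurableConstSMul Γ X] {ν : Measure X} [SigmaFinite ν] [ErgodicSMul Γ X ν] {Y : Set X}
    (h : HasLocalSpectralGap 𝕜 ℓ ν Y) (hY : MeasurableSet Y) (h0 : ν Y ≠ 0) (htop : ν Y ≠ ∞) :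
    IsStronglyErgodic Γ ν := by
  classical
  obtain ⟨κ, -, k, hgap⟩ := h
  have : NeZero ν := ⟨fun h => h0 (by simp [h])⟩
  refine ⟨ν.toFinite, inferInstance, toFinite_absolutelyContinuous ν,
    absolutelyContinuous_toFinite ν, fun C hCm hC => ?_⟩
  set D : ℕ → Set X := fun n => if ν (C n ∩ Y) ≤ ν Y / 2 then C n else (C n)ᶜ with hDdef
  have hDor : ∀ n, D n = C n ∨ D n = (C n)ᶜ := fun n => by
    by_cases hn : ν (C n ∩ Y) ≤ ν Y / 2 <;> simp [hDdef, hn]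
  have hDm : ∀ n, MeasurableSet (D n) := fun n => by
    rcases hDor n with h | h <;> rw [h]
    exacts [hCm n, (hCm n).compl]
  have hDinv : ∀ n (γ : Γ), D n ∆ (γ • D n) = C n ∆ (γ • C n) := fun n γ => by
    rcases hDor n with h | h <;> rw [h]
    exact compl_symmDiff_smul_compl γ _
  have hDY : ∀ n, ν (D n ∩ Y) ≤ ν Y / 2 := fun n => by
    by_cases hn : ν (C n ∩ Y) ≤ ν Y / 2
    · simp [hDdef, hn]
    · simp only [hDdef, if_neg hn]
      by_contra! hn'
      have h1 := ENNReal.add_lt_add (not_le.1 hn) hn'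
      rw [ENNReal.add_halves, Set.inter_comm, Set.inter_comm _ Y, ← Set.sdiff_eq,
        measure_inter_add_sdiff _ (hCm n)] at h1
      exact h1.false
  have hDC : ∀ T : Set X, MeasurableSet T → ν T ≠ ∞ → ∀ γ : Γ,
      Tendsto (fun n => ν ((D n ∆ (γ • D n)) ∩ T)) atTop (𝓝 0) := fun T hT hTt γ => by
    simp_rw [hDinv]
    exact tendsto_measure_inter_zero_of_absolutelyContinuous (absolutelyContinuous_toFinite ν)
      hT hTt (hC γ)
  have hDYlim : Tendsto (fun n => ν (D n ∩ Y)) atTop (𝓝 0) := by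
    rw [← tendsto_rpow_half_zero_iff]
    have hs : Tendsto (fun n => ∑ γ ∈ ℓ.ball k, ν ((D n ∆ (γ • D n)) ∩ Y) ^ (1 / 2 : ℝ)) atTop
        (𝓝 0) := by
      simpa using tendsto_finsetSum (ℓ.ball k) fun γ _ =>
        tendsto_rpow_half_zero_iff.2 (hDC Y hY htop γ)
    have hs2 := ENNReal.Tendsto.const_mul (a := 2) (ENNReal.Tendsto.const_mul
      (a := ENNReal.ofReal κ) hs (Or.inr ENNReal.ofReal_ne_top)) (Or.inr (by simp))
    rw [mul_zero, mul_zero] at hs2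
    exact tendsto_of_tendsto_of_tendsto_of_le_of_le tendsto_const_nhds hs2 (fun _ => zero_le)
      fun n => measure_inter_rpow_le_of_localSpectralGap 𝕜 hY h0 htop hgap (hDm n) (hDY n)
  have hDlim : Tendsto (fun n => ν.toFinite (D n)) atTop (𝓝 0) := by
    refine tendsto_measure_zero_of_inter_smul (Γ := Γ) (toFinite_absolutelyContinuous ν) hY h0 htop
      hDm fun γ => ?_
    -- A point of `D n ∩ γ • Y` lies in `γ • (D n ∩ Y)` or in `D n ∆ (γ • D n)`.
    have hsum := hDYlim.add (hDC (γ • Y) (hY.const_smul γ) (by rwa [measure_smul]) γ)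
    rw [add_zero] at hsum
    refine tendsto_of_tendsto_of_tendsto_of_le_of_le tendsto_const_nhds hsum
      (fun _ => zero_le) fun n => ?_
    dsimp only
    rw [← measure_smul ν γ (D n ∩ Y), Set.smul_set_inter]
    refine (measure_mono fun x hx => ?_).trans (measure_union_le _ _)
    by_cases hxD : x ∈ γ • D n
    · exact Or.inl ⟨hxD, hx.2⟩
    · exact Or.inr ⟨Or.inl ⟨hx.1, hxD⟩, hx.2⟩
  refine tendsto_of_tendsto_of_tendsto_of_le_of_le tendsto_const_nhds hDlim
    (fun _ => zero_le) fun n => ?_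
  rcases hDor n with h | h <;> dsimp only <;> rw [h]
  · exact mul_le_of_le_one_right' tsub_le_self
  · rw [one_sub_measure_eq (hCm n)]
    exact mul_le_of_le_one_left' prob_le_one

/-! ### Exhaustion and a domain of expansion -/

/-- Exhaustion: a family of sets closed under increasing unions, and of bounded measure,
contains an element which is maximal up to null sets. -/
theorem exists_superset_measure_maximal {X : Type*} [MeasurableSpace X] {μ : Measure X}
    {P : Set X → Prop} {A₀ : Set X} (h0 : P A₀) (hfin : ∀ A, P A → μ A ≠ ∞)
    (hP : ∀ A : ℕ → Set X, Monotone A → (∀ n, P (A n)) → P (⋃ n, A n)) :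
    ∃ A, P A ∧ ∀ A', P A' → A ⊆ A' → μ A' ≤ μ A := by
  set s : Set X → ℝ≥0∞ := fun A => ⨆ A' : {A' // P A' ∧ A ⊆ A'}, μ A' with hs
  have hle : ∀ {A A'}, P A' → A ⊆ A' → μ A' ≤ s A := fun {A A'} h h' =>
    le_iSup (fun A' : {A' // P A' ∧ A ⊆ A'} => μ A') ⟨A', h, h'⟩
  -- A greedy choice, nearly attaining the supremum over supersets. The cap `n` handles an infinite
  -- supremum.
  have hstep : ∀ (n : ℕ) (A : {A // P A}), ∃ A' : {A // P A}, A.1 ⊆ A'.1 ∧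
      min (s A.1) n ≤ μ A'.1 + ((n : ℝ≥0∞) + 1)⁻¹ := by
    rintro n ⟨A, hA⟩
    by_contra! hcon
    have hlt : ∀ A' : {A' // P A' ∧ A ⊆ A'},
        μ A' + ((n : ℝ≥0∞) + 1)⁻¹ ≤ min (s A) n := fun A' => (hcon ⟨A', A'.2.1⟩ A'.2.2).le
    have : Nonempty {A' // P A' ∧ A ⊆ A'} := ⟨⟨A, hA, subset_rfl⟩⟩
    have h1 : s A + ((n : ℝ≥0∞) + 1)⁻¹ ≤ min (s A) n := by
      rw [hs, ENNReal.iSup_add]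
      exact iSup_le hlt
    have hne : min (s A) n ≠ ∞ := ne_top_of_le_ne_top (ENNReal.natCast_ne_top n) (min_le_right _ _)
    have h2 : s A ≠ ∞ := ne_top_of_le_ne_top hne (le_self_add.trans h1)
    exact absurd (h1.trans (min_le_left _ _)) (not_le.2 (ENNReal.lt_add_right h2 (by simp)))
  choose next hsub hnext using hstep
  let F : ℕ → {A // P A} := fun n => Nat.rec ⟨A₀, h0⟩ next n
  have hmono : Monotone fun n => (F n).1 := monotone_nat_of_le_succ fun n => hsub n (F n)
  refine ⟨⋃ n, (F n).1, hP _ hmono fun n => (F n).2, fun A' hA' hsubA => ?_⟩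
  have hA'fin := hfin A' hA'
  obtain ⟨N, hN⟩ := ENNReal.exists_nat_gt hA'fin
  have hlim : Tendsto (fun n : ℕ => μ (⋃ n, (F n).1) + ((n : ℝ≥0∞) + 1)⁻¹) atTop
      (𝓝 (μ (⋃ n, (F n).1))) := by
    have h := (tendsto_add_atTop_iff_nat 1).2 ENNReal.tendsto_inv_nat_nhds_zero
    simpa using (tendsto_const_nhds (x := μ (⋃ n, (F n).1))).add h
  refine ge_of_tendsto hlim ?_
  filter_upwards [eventually_ge_atTop N] with n hn
  have h1 : μ A' ≤ min (s (F n).1) n :=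
    le_min (hle hA' ((Set.subset_iUnion (fun n => (F n).1) n).trans hsubA))
      (hN.le.trans (by exact_mod_cast hn))
  exact h1.trans ((hnext n (F n)).trans (by
    gcongr
    exact Set.subset_iUnion (fun n => (F n).1) (n + 1)))

/-- Asymptotic expansion on `Y₀` yields genuine expansion on a subset of positive measure. -/
theorem exists_subset_expansion {Γ X : Type*} [Group Γ] [MeasurableSpace X]
    [MulAction Γ X] [MeasurableConstSMul Γ X] {ν : Measure X} [SMulInvariantMeasure Γ X ν]
    {Y₀ : Set X} (hY₀ : MeasurableSet Y₀) (h0 : ν Y₀ ≠ 0) (htop : ν Y₀ ≠ ∞) {B : Finset Γ}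
    {δ : ℝ≥0∞} (hδ : δ ≠ 0)
    (h : ∀ A ⊆ Y₀, MeasurableSet A → ν Y₀ / 4 ≤ ν A → ν Y₀ / 4 ≤ ν (Y₀ \ A) →
      δ ≤ ∑ γ ∈ B, ν ((γ • A ∩ Y₀) \ A)) :
    ∃ Y ⊆ Y₀, MeasurableSet Y ∧ ν Y ≠ 0 ∧ ∃ c : ℝ≥0∞, c ≠ 0 ∧ c ≠ ∞ ∧
      ∀ A ⊆ Y, MeasurableSet A → ν A ≤ ν Y / 2 → c * ν A ≤ ∑ γ ∈ B, ν ((γ • A ∩ Y) \ A) := by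
  -- With `c * ν Y₀ < δ`, no set of intermediate size can have boundary at most `c` times its
  -- measure. The minimum with `1` keeps `c` finite when `δ = ∞`.
  obtain ⟨c, hc0, hc⟩ : ∃ c : ℝ≥0∞, 0 < c ∧ c * ν Y₀ < min δ 1 := by
    have hm : 0 < min δ 1 := lt_min hδ.bot_lt one_pos
    refine ⟨min δ 1 / 2 / ν Y₀, ENNReal.div_pos (ENNReal.half_pos hm.ne').ne' htop, ?_⟩
    rw [ENNReal.div_mul_cancel h0 htop]
    exact ENNReal.half_lt_self hm.ne' (ne_top_of_le_ne_top (by simp) (min_le_right _ _))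
  have hcδ : c * ν Y₀ < δ := hc.trans_le (min_le_left _ _)
  have hctop : c ≠ ∞ := by
    rintro rfl
    rw [ENNReal.top_mul h0] at hc
    exact not_top_lt hc
  -- The poorly expanding sets, kept away from full measure; by the choice of `c` they have measure
  -- below `ν Y₀ / 4`.
  set P : Set X → Prop := fun F => F ⊆ Y₀ ∧ MeasurableSet F ∧ ν Y₀ / 4 ≤ ν (Y₀ \ F) ∧
    ∑ γ ∈ B, ν ((γ • F ∩ Y₀) \ F) ≤ c * ν F with hPdef
  have hsmall : ∀ F, P F → ν F < ν Y₀ / 4 := by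
    rintro F ⟨h1, h2, h3, h4⟩
    by_contra! h5
    exact absurd ((h F h1 h2 h5 h3).trans (h4.trans (mul_le_mul_right (measure_mono h1) c)))
      (not_le.2 hcδ)
  have hle4 : ν Y₀ / 4 ≤ ν Y₀ := ENNReal.div_le_of_le_mul (le_mul_of_one_le_right' (by norm_num))
  obtain ⟨F, hF, hmax⟩ := exists_superset_measure_maximal (μ := ν) (P := P) (A₀ := ∅)
    ⟨Set.empty_subset _, .empty, by simpa using hle4, by simp⟩
    (fun A hA => ne_top_of_le_ne_top htop (measure_mono hA.1)) (by
      intro A hmono hA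
      refine ⟨Set.iUnion_subset fun n => (hA n).1, .iUnion fun n => (hA n).2.1, ?_, ?_⟩
      · rw [Set.sdiff_iUnion]
        refine ge_of_tendsto' (tendsto_measure_iInter_atTop
          (fun n => (hY₀.diff (hA n).2.1).nullMeasurableSet)
          (fun a b hab => Set.sdiff_subset_sdiff_right (hmono hab))
          ⟨0, ne_top_of_le_ne_top htop (measure_mono Set.sdiff_subset)⟩) fun n => (hA n).2.2.1
      · have hlim : ∀ γ : Γ, Tendsto (fun n => ν ((γ • A n ∩ Y₀) \ ⋃ n, A n)) atTop
            (𝓝 (ν ((γ • (⋃ n, A n) ∩ Y₀) \ ⋃ n, A n))) := fun γ => by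
          rw [Set.smul_set_iUnion, Set.iUnion_inter, Set.iUnion_sdiff]
          exact tendsto_measure_iUnion_atTop fun a b hab =>
            Set.sdiff_subset_sdiff_left (Set.inter_subset_inter_left _
              (Set.smul_set_mono (hmono hab)))
        refine le_of_tendsto' (tendsto_finsetSum B fun γ _ => hlim γ) fun n => ?_
        calc _ ≤ ∑ γ ∈ B, ν ((γ • A n ∩ Y₀) \ A n) := Finset.sum_le_sum fun γ _ =>
              measure_mono (Set.sdiff_subset_sdiff_right (Set.subset_iUnion A n))
          _ ≤ c * ν (A n) := (hA n).2.2.2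
          _ ≤ _ := mul_le_mul_right (measure_mono (Set.subset_iUnion A n)) c)
  have hF4 := hsmall F hF
  obtain ⟨hFY, hFm, hF3, hFb⟩ := hF
  have hFtop : ν F ≠ ∞ := hF4.ne_top
  have h4 : ν Y₀ / 4 ≠ 0 := by simp [ENNReal.div_eq_zero_iff, h0]
  refine ⟨Y₀ \ F, Set.sdiff_subset, hY₀.diff hFm, fun h => h4 (by simpa [h] using hF3), c, hc0.ne',
    hctop, fun A hAY hAm hA2 => ?_⟩
  -- A badly expanding `A` could be added to `F`. Maximality then makes `A` null, which contradicts
  -- the strict inequality `hbad`.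
  by_contra! hbad
  have hdisj : Disjoint F A := Set.disjoint_left.2 fun x hxF hxA => (hAY hxA).2 hxF
  have hun : ν (F ∪ A) = ν F + ν A := measure_union hdisj hAm
  have hPun : P (F ∪ A) := by
    refine ⟨Set.union_subset hFY (hAY.trans Set.sdiff_subset), hFm.union hAm, ?_, ?_⟩
    -- More than `3/4` of `Y₀` lies outside `F` and `A` takes at most half of that, so at least
    -- `3/8` remains.
    · have hYtop : ν (Y₀ \ F) ≠ ∞ := ne_top_of_le_ne_top htop (measure_mono Set.sdiff_subset)
      have e1 : ν (Y₀ \ F) = ν A + ν (Y₀ \ (F ∪ A)) := by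
        rw [← Set.sdiff_sdiff, ← measure_inter_add_sdiff (Y₀ \ F) hAm,
          Set.inter_eq_self_of_subset_right hAY]
      have e2 : ν Y₀ = ν F + ν (Y₀ \ F) := by
        rw [← measure_inter_add_sdiff Y₀ hFm, Set.inter_eq_self_of_subset_right hFY]
      have f1 : ν A ≠ ∞ := ne_top_of_le_ne_top hYtop (measure_mono hAY)
      have f2 : ν (Y₀ \ (F ∪ A)) ≠ ∞ := ne_top_of_le_ne_top htop (measure_mono Set.sdiff_subset)
      rw [e2] at hF4 ⊢
      rw [e1] at hF4 hA2 ⊢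
      lift ν F to NNReal using hFtop with a
      lift ν A to NNReal using f1 with b
      lift ν (Y₀ \ (F ∪ A)) to NNReal using f2 with d
      have q4 : (4 : ℝ≥0∞) = ((4 : NNReal) : ℝ≥0∞) := rfl
      have q2 : (2 : ℝ≥0∞) = ((2 : NNReal) : ℝ≥0∞) := rfl
      rw [q4, ← ENNReal.coe_add, ← ENNReal.coe_add, ← ENNReal.coe_div (by norm_num)] at hF4 ⊢
      rw [q2, ← ENNReal.coe_add, ← ENNReal.coe_div (by norm_num)] at hA2
      norm_cast at hF4 hA2 ⊢
      rw [← NNReal.coe_le_coe] at hA2 ⊢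
      rw [← NNReal.coe_lt_coe] at hF4
      push_cast at *
      linarith
    · rw [hun, mul_add]
      refine le_trans ?_ (add_le_add hFb hbad.le)
      rw [← Finset.sum_add_distrib]
      refine Finset.sum_le_sum fun γ _ => (measure_mono fun x hx => ?_).trans (measure_union_le _ _)
      rw [Set.smul_set_union] at hx
      obtain ⟨⟨hx1 | hx1, hx2⟩, hx3⟩ := hx
      · exact Or.inl ⟨⟨hx1, hx2⟩, fun h => hx3 (Or.inl h)⟩
      · exact Or.inr ⟨⟨hx1, hx2, fun h => hx3 (Or.inl h)⟩, fun h => hx3 (Or.inr h)⟩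
  have hA0 : ν A = 0 := by
    have := hmax _ hPun Set.subset_union_left
    rw [hun] at this
    by_contra hne
    exact absurd this (not_le.2 (ENNReal.lt_add_right hFtop hne))
  simp [hA0] at hbad

/-! ### Cheeger's inequality on half of `Y` -/

/-- Layer cake formula for the positive part of a difference. -/
theorem lintegral_ofReal_sub_eq_lintegral_meas {X : Type*} [MeasurableSpace X] {μ : Measure X}
    [SFinite μ] {u v : X → ℝ} (hu : Measurable u) (hv : Measurable v) :
    ∫⁻ x, ENNReal.ofReal (v x - u x) ∂μ = ∫⁻ t : ℝ, μ {x | u x ≤ t ∧ t < v x} := by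
  have hm : MeasurableSet {p : X × ℝ | u p.1 ≤ p.2 ∧ p.2 < v p.1} :=
    (measurableSet_le (hu.comp measurable_fst) measurable_snd).inter
      (measurableSet_lt measurable_snd (hv.comp measurable_fst))
  have h1 := Measure.prod_apply (μ := μ) (ν := (volume : Measure ℝ)) hm
  rw [Measure.prod_apply_symm hm] at h1
  refine (Eq.trans ?_ h1.symm)
  exact lintegral_congr fun x => Real.volume_Ico.symm

/-- Isoperimetric inequality integrated over the level sets of `u`. -/
theorem lintegral_le_sum_lintegral_sub {Γ X : Type*} [Group Γ] [MeasurableSpace X]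
    [MulAction Γ X] [MeasurableConstSMul Γ X] {ν : Measure X} [SFinite ν]
    {Y : Set X} (hY : MeasurableSet Y) {B : Finset Γ} {c : ℝ≥0∞} (hc : c ≠ ∞)
    (h : ∀ A ⊆ Y, MeasurableSet A → ν A ≤ ν Y / 2 → c * ν A ≤ ∑ γ ∈ B, ν ((γ • A ∩ Y) \ A))
    {u : X → ℝ} (hu : Measurable u) (hsupp : ν (Y ∩ {x | 0 < u x}) ≤ ν Y / 2) :
    c * ∫⁻ x in Y, ENNReal.ofReal (u x) ∂ν ≤
      ∑ γ ∈ B, ∫⁻ x in Y ∩ γ • Y, ENNReal.ofReal (u (γ⁻¹ • x) - u x) ∂ν := by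
  have hγ : ∀ γ : Γ, Measurable fun x : X => u (γ⁻¹ • x) := fun γ =>
    hu.comp (measurable_const_smul γ⁻¹)
  have hmeas : ∀ (μ : Measure X) [SFinite μ] {w v : X → ℝ}, Measurable w → Measurable v →
      Measurable fun t : ℝ => μ {x | w x ≤ t ∧ t < v x} := fun μ _ w v hw hv =>
    measurable_measure_prodMk_right (μ := μ) (s := {p : X × ℝ | w p.1 ≤ p.2 ∧ p.2 < v p.1})
      ((measurableSet_le (hw.comp measurable_fst) measurable_snd).inter
        (measurableSet_lt measurable_snd (hv.comp measurable_fst)))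
  have hL := lintegral_ofReal_sub_eq_lintegral_meas (μ := ν.restrict Y)
    (measurable_const (a := (0 : ℝ))) hu
  simp only [sub_zero] at hL
  rw [hL, ← lintegral_const_mul' _ _ hc]
  simp_rw [lintegral_ofReal_sub_eq_lintegral_meas hu (hγ _)]
  rw [← lintegral_finsetSum _ fun γ _ => hmeas _ hu (hγ γ)]
  refine lintegral_mono fun t => ?_
  have hYγ : ∀ γ : Γ, MeasurableSet (Y ∩ γ • Y) := fun γ => hY.inter (hY.const_smul γ)
  dsimp only
  simp_rw [Measure.restrict_apply' (hYγ _)]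
  rw [Measure.restrict_apply' hY]
  rcases lt_or_ge t 0 with ht | ht
  · have : {x : X | 0 ≤ t ∧ t < u x} = ∅ := by ext x; simp [ht]
    simp [this]
  · have hsub : {x : X | 0 ≤ t ∧ t < u x} ∩ Y ⊆ Y ∩ {x | 0 < u x} :=
      fun x hx => ⟨hx.2, ht.trans_lt hx.1.2⟩
    have hset : MeasurableSet {x : X | 0 ≤ t ∧ t < u x} :=
      (MeasurableSet.const _).inter (measurableSet_lt measurable_const hu)
    have hA := h ({x : X | 0 ≤ t ∧ t < u x} ∩ Y) Set.inter_subset_right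
      (hset.inter hY) ((measure_mono hsub).trans hsupp)
    -- A boundary point of the level set has both `x` and `γ⁻¹ • x` in `Y` and satisfies `u x ≤ t <
    -- u (γ⁻¹ • x)`. Integrating over `Y ∩ γ • Y` only is what later allows bounds by norms on `Y`.
    refine hA.trans (Finset.sum_le_sum fun γ _ => measure_mono ?_)
    rintro x ⟨⟨hx1, hx2⟩, hx3⟩
    rw [Set.mem_smul_set_iff_inv_smul_mem] at hx1
    refine ⟨⟨?_, hx1.1.2⟩, hx2, Set.mem_smul_set_iff_inv_smul_mem.2 hx1.2⟩
    by_contra! hlt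
    exact hx3 ⟨⟨ht, hlt⟩, hx2⟩

theorem eLpNorm_two_sq {X E : Type*} [MeasurableSpace X] [NormedAddCommGroup E] {μ : Measure X}
    (f : X → E) : eLpNorm f 2 μ * eLpNorm f 2 μ = ∫⁻ x, ‖f x‖ₑ ^ 2 ∂μ := by
  rw [← sq]
  have := eLpNorm_nnreal_pow_eq_lintegral (μ := μ) (f := f) (p := 2) (by simp)
  simpa using! this

/-- Cheeger's inequality for functions supported on at most half of `Y`. -/
theorem cheeger_half_support {Γ X : Type*} [Group Γ] [MeasurableSpace X]
    [MulAction Γ X] [MeasurableConstSMul Γ X] {ν : Measure X} [SFinite ν]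
    [SMulInvariantMeasure Γ X ν] {Y : Set X} (hY : MeasurableSet Y) {B : Finset Γ} {c : ℝ≥0∞}
    (hc : c ≠ ∞)
    (h : ∀ A ⊆ Y, MeasurableSet A → ν A ≤ ν Y / 2 → c * ν A ≤ ∑ γ ∈ B, ν ((γ • A ∩ Y) \ A))
    {g : X → ℝ} (hg : Measurable g) (hg0 : ∀ x, 0 ≤ g x) (hsupp : ν (Y ∩ {x | 0 < g x}) ≤ ν Y / 2)
    (hfin : localNorm ν Y g ≠ ∞) :
    c * localNorm ν Y g ≤ 2 * ∑ γ ∈ B, localNorm ν Y (fun x => g (γ⁻¹ • x) - g x) := by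
  rcases eq_or_ne (localNorm ν Y g) 0 with hz | hz
  · simp [hz]
  have hsub : Y ∩ {x | 0 < g x ^ 2} ⊆ Y ∩ {x | 0 < g x} := fun x hx => ⟨hx.1, by
    have : 0 < g x ^ 2 := hx.2
    exact (hg0 x).lt_of_ne fun h => by simp [← h] at this⟩
  -- Applied to `g ^ 2`: the difference of squares factors as `(a - b)(a + b)`, and Hölder bounds
  -- the second factor by `2 ‖g‖_{Y,2}`, which is cancelled at the end.
  have h1 := lintegral_le_sum_lintegral_sub hY hc h (u := fun x => g x ^ 2) (hg.pow_const 2)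
    ((measure_mono hsub).trans hsupp)
  have h2 : ∫⁻ x in Y, ENNReal.ofReal (g x ^ 2) ∂ν = localNorm ν Y g * localNorm ν Y g := by
    rw [localNorm, eLpNorm_two_sq]
    refine lintegral_congr fun x => ?_
    rw [Real.enorm_eq_ofReal (hg0 x), ENNReal.ofReal_pow (hg0 x)]
  have h3 : ∀ γ ∈ B, ∫⁻ x in Y ∩ γ • Y, ENNReal.ofReal (g (γ⁻¹ • x) ^ 2 - g x ^ 2) ∂ν ≤
      localNorm ν Y (fun x => g (γ⁻¹ • x) - g x) * (2 * localNorm ν Y g) := fun γ _ => by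
    have hgγ : Measurable fun x : X => g (γ⁻¹ • x) := hg.comp (measurable_const_smul γ⁻¹)
    have hH := eLpNorm_smul_le_mul_eLpNorm (μ := ν.restrict (Y ∩ γ • Y)) (p := 2) (q := 2) (r := 1)
      (f := fun x => g (γ⁻¹ • x) + g x) (φ := fun x => g (γ⁻¹ • x) - g x)
      (hgγ.add hg).aestronglyMeasurable (hgγ.sub hg).aestronglyMeasurable
    have hb : eLpNorm (fun x => g (γ⁻¹ • x) + g x) 2 (ν.restrict (Y ∩ γ • Y)) ≤
        2 * localNorm ν Y g := by
      rw [two_mul]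
      refine (eLpNorm_add_le hgγ.aestronglyMeasurable hg.aestronglyMeasurable (by simp)).trans
        (add_le_add ?_ (eLpNorm_mono_measure _ (Measure.restrict_mono_set _ Set.inter_subset_left)))
      refine (eLpNorm_mono_measure _ (Measure.restrict_mono_set _ Set.inter_subset_right)).trans_eq ?_
      have hmp : MeasurePreserving (fun x : X => γ⁻¹ • x) (ν.restrict (γ • Y)) (ν.restrict Y) := by
        have := (measurePreserving_smul γ⁻¹ ν).restrict_preimage hY
        rwa [Set.preimage_smul, inv_inv] at this
      exact eLpNorm_comp_measurePreserving hg.aestronglyMeasurable hmp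
    calc _ ≤ eLpNorm ((fun x => g (γ⁻¹ • x) - g x) • fun x => g (γ⁻¹ • x) + g x) 1
          (ν.restrict (Y ∩ γ • Y)) := by
          rw [eLpNorm_one_eq_lintegral_enorm]
          refine lintegral_mono fun x => ?_
          simp only [Pi.smul_apply', smul_eq_mul]
          rw [← ofReal_norm]
          refine ENNReal.ofReal_le_ofReal (le_trans (le_of_eq ?_) (Real.le_norm_self _))
          ring
      _ ≤ _ := hH.trans (mul_le_mul'
          (eLpNorm_mono_measure _ (Measure.restrict_mono_set _ Set.inter_subset_left)) hb)
  rw [h2] at h1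
  have h4 := h1.trans (Finset.sum_le_sum h3)
  rw [← Finset.sum_mul, ← mul_assoc, ← mul_assoc, ENNReal.mul_le_mul_iff_left hz hfin] at h4
  rwa [mul_comm 2]

/-! ### Medians, means and the general Cheeger inequality -/

/-- A measurable real function on a finite measure space has a median. -/
theorem exists_median {X : Type*} [MeasurableSpace X] {μ : Measure X} [IsFiniteMeasure μ]
    {f : X → ℝ} (hf : Measurable f) :
    ∃ m : ℝ, μ {x | m < f x} ≤ μ Set.univ / 2 ∧ μ {x | f x < m} ≤ μ Set.univ / 2 := by
  rcases eq_or_ne (μ Set.univ) 0 with hz | hz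
  · exact ⟨0, by simp [measure_mono_null (Set.subset_univ _) hz],
      by simp [measure_mono_null (Set.subset_univ _) hz]⟩
  have hhalf : μ Set.univ / 2 < μ Set.univ := ENNReal.half_lt_self hz (measure_ne_top _ _)
  set S : Set ℝ := {t | μ {x | t < f x} ≤ μ Set.univ / 2} with hS
  have hup : ∀ {s t : ℝ}, s ≤ t → s ∈ S → t ∈ S := fun hst hs =>
    (measure_mono fun x hx => lt_of_le_of_lt hst hx).trans hs
  have hne : S.Nonempty := by
    have h := tendsto_measure_iInter_atTop (μ := μ) (s := fun n : ℕ => {x | (n : ℝ) < f x})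
      (fun n => (measurableSet_lt measurable_const hf).nullMeasurableSet)
      (fun a b hab x (hx : (b : ℝ) < f x) =>
        show (a : ℝ) < f x from lt_of_le_of_lt (Nat.cast_le.2 hab) hx) ⟨0, measure_ne_top _ _⟩
    have he : (⋂ n : ℕ, {x | (n : ℝ) < f x}) = ∅ := by
      refine Set.eq_empty_of_forall_notMem fun x hx => ?_
      obtain ⟨n, hn⟩ := exists_nat_gt (f x)
      exact absurd (Set.mem_iInter.1 hx n) (not_lt.2 hn.le)
    rw [he, measure_empty] at h
    obtain ⟨n, hn⟩ := (h.eventually_lt_const (ENNReal.half_pos hz)).exists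
    exact ⟨n, hn.le⟩
  have hbdd : BddBelow S := by
    have h := tendsto_measure_iUnion_atTop (μ := μ) (s := fun n : ℕ => {x | -(n : ℝ) < f x})
      (fun a b hab x (hx : -(a : ℝ) < f x) =>
        show -(b : ℝ) < f x from lt_of_le_of_lt (neg_le_neg (Nat.cast_le.2 hab)) hx)
    have he : (⋃ n : ℕ, {x | -(n : ℝ) < f x}) = Set.univ := by
      refine Set.eq_univ_of_forall fun x => ?_
      obtain ⟨n, hn⟩ := exists_nat_gt (-f x)
      exact Set.mem_iUnion.2 ⟨n, by simpa using neg_lt.1 hn⟩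
    rw [he] at h
    obtain ⟨n, hn⟩ := (h.eventually_const_lt hhalf).exists
    refine ⟨-(n : ℝ), fun t ht => ?_⟩
    by_contra! hlt
    exact absurd (hup hlt.le ht) (not_le.2 hn)
  obtain ⟨b, hbanti, hbgt, hblim⟩ := exists_seq_strictAnti_tendsto (sInf S)
  obtain ⟨a, hamono, halt, halim⟩ := exists_seq_strictMono_tendsto (sInf S)
  refine ⟨sInf S, ?_, ?_⟩
  · have h := tendsto_measure_iUnion_atTop (μ := μ) (s := fun n : ℕ => {x | b n < f x})
      (fun i j hij x hx => lt_of_le_of_lt (hbanti.antitone hij) hx)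
    have he : (⋃ n : ℕ, {x | b n < f x}) = {x | sInf S < f x} := by
      ext x
      simp only [Set.mem_iUnion, Set.mem_ofPred_eq]
      exact ⟨fun ⟨n, hn⟩ => (hbgt n).trans hn, fun hx => (hblim.eventually_lt_const hx).exists⟩
    rw [he] at h
    refine le_of_tendsto' h fun n => ?_
    obtain ⟨s, hs, hsb⟩ := exists_lt_of_csInf_lt hne (hbgt n)
    exact hup hsb.le hs
  · have h := tendsto_measure_iUnion_atTop (μ := μ) (s := fun n : ℕ => {x | f x ≤ a n})
      (fun i j hij x hx => le_trans hx (hamono.monotone hij))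
    have he : (⋃ n : ℕ, {x | f x ≤ a n}) = {x | f x < sInf S} := by
      ext x
      simp only [Set.mem_iUnion, Set.mem_ofPred_eq]
      exact ⟨fun ⟨n, hn⟩ => hn.trans_lt (halt n),
        fun hx => (halim.eventually_const_le hx).exists⟩
    rw [he] at h
    refine le_of_tendsto' h fun n => ?_
    -- `a n` lies below the infimum of `S`, hence outside `S`.
    have hn : μ Set.univ / 2 < μ {x | a n < f x} :=
      not_le.1 fun hle => absurd (csInf_le hbdd hle) (not_le.2 (halt n))
    by_contra! hlt
    dsimp only [Function.comp_apply] at hlt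
    have h1 := ENNReal.add_lt_add hlt hn
    have hcompl : {x | a n < f x} = {x | f x ≤ a n}ᶜ := by ext x; simp
    rw [ENNReal.add_halves, hcompl, measure_add_measure_compl
      (measurableSet_le hf measurable_const)] at h1
    exact h1.false

/-- Subtracting the mean decreases the `L²` norm. -/
theorem eLpNorm_two_le_sub_const {X : Type*} [MeasurableSpace X] {μ : Measure X}
    [IsFiniteMeasure μ] {f : X → ℝ} (hf : MemLp f 2 μ) (h0 : ∫ x, f x ∂μ = 0) (m : ℝ) :
    eLpNorm f 2 μ ≤ eLpNorm (fun x => f x - m) 2 μ := by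
  have hfm : MemLp (fun x => f x - m) 2 μ := hf.sub (memLp_const m)
  have hsq : ∀ {g : X → ℝ}, MemLp g 2 μ →
      eLpNorm g 2 μ ^ 2 = ENNReal.ofReal (∫ x, g x ^ 2 ∂μ) := fun {g} hg => by
    rw [sq, eLpNorm_two_sq, ofReal_integral_eq_lintegral_ofReal hg.integrable_sq
      (Eventually.of_forall fun x => sq_nonneg _)]
    refine lintegral_congr fun x => ?_
    rw [← ofReal_norm, ← ENNReal.ofReal_pow (norm_nonneg _), Real.norm_eq_abs, sq_abs]
  rw [← ENNReal.pow_le_pow_left_iff (two_ne_zero), hsq hf, hsq hfm]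
  refine ENNReal.ofReal_le_ofReal ?_
  have hfi : Integrable f μ := hf.integrable (by norm_num)
  have : ∫ x, (f x - m) ^ 2 ∂μ = ∫ x, f x ^ 2 ∂μ + μ.real Set.univ * m ^ 2 := by
    have e : ∀ x, (f x - m) ^ 2 = f x ^ 2 - 2 * m * f x + m ^ 2 := fun x => by ring
    simp_rw [e]
    rw [integral_add (f := fun x => f x ^ 2 - 2 * m * f x)
        (hf.integrable_sq.sub (hfi.const_mul _)) (integrable_const _),
      integral_sub hf.integrable_sq (hfi.const_mul _), integral_const_mul, h0, integral_const]
    simp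
  rw [this]
  exact le_add_of_nonneg_right (by positivity)

theorem localNorm_mono {X 𝕜 𝕜' : Type*} [MeasurableSpace X] [RCLike 𝕜] [RCLike 𝕜'] {ν : Measure X}
    {Y : Set X} {f : X → 𝕜} {g : X → 𝕜'} (h : ∀ x, ‖f x‖ ≤ ‖g x‖) :
    localNorm ν Y f ≤ localNorm ν Y g :=
  eLpNorm_mono h

section

variable {Γ X : Type*} [Group Γ] [MeasurableSpace X] [MulAction Γ X] [MeasurableConstSMul Γ X]
  {ν : Measure X} [SMulInvariantMeasure Γ X ν] {Y : Set X} {B : Finset Γ}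
  {c : ℝ≥0∞}

theorem localNorm_smul_sub_congr {𝕜 : Type*} [RCLike 𝕜] {f g : X → 𝕜} (hfg : f =ᵐ[ν] g) (γ : Γ) :
    localNorm ν Y (fun x => f (γ⁻¹ • x) - f x) = localNorm ν Y (fun x => g (γ⁻¹ • x) - g x) := by
  refine eLpNorm_congr_ae (ae_restrict_of_ae ?_)
  have h := (measurePreserving_smul γ⁻¹ ν).quasiMeasurePreserving.ae_eq_comp hfg
  filter_upwards [h, hfg] with x h1 h2
  rw [h2]
  exact congrArg (· - g x) h1

variable [SigmaFinite ν]

/-- Cheeger's inequality for measurable real functions of mean zero. -/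
theorem cheeger_of_measurable (hY : MeasurableSet Y) (htop : ν Y ≠ ∞) (hc : c ≠ ∞)
    (h : ∀ A ⊆ Y, MeasurableSet A → ν A ≤ ν Y / 2 → c * ν A ≤ ∑ γ ∈ B, ν ((γ • A ∩ Y) \ A))
    {f : X → ℝ} (hf : Measurable f) (hf2 : MemLp f 2 ν) (h0 : ∫ x in Y, f x ∂ν = 0) :
    c * localNorm ν Y f ≤ 4 * ∑ γ ∈ B, localNorm ν Y (fun x => f (γ⁻¹ • x) - f x) := by
  have : IsFiniteMeasure (ν.restrict Y) := isFiniteMeasure_restrict.2 htop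
  obtain ⟨m, hm1, hm2⟩ := exists_median (μ := ν.restrict Y) hf
  rw [Measure.restrict_apply_univ, Measure.restrict_apply' hY, Set.inter_comm] at hm1 hm2
  have hfm : localNorm ν Y (fun x => f x - m) ≠ ∞ :=
    ((hf2.restrict Y).sub (memLp_const m)).eLpNorm_ne_top
  -- Meant for the positive and negative parts of `f - m`: each lives on at most half of `Y` and,
  -- being a 1-Lipschitz function of `f`, has no larger differences along the action.
  have hhalf : ∀ g : X → ℝ, Measurable g → (∀ x, 0 ≤ g x) → ν (Y ∩ {x | 0 < g x}) ≤ ν Y / 2 →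
      (∀ x, ‖g x‖ ≤ ‖f x - m‖) → (∀ x y, ‖g x - g y‖ ≤ ‖f x - f y‖) →
      c * localNorm ν Y g ≤ 2 * ∑ γ ∈ B, localNorm ν Y (fun x => f (γ⁻¹ • x) - f x) :=
    fun g hg hg0 hgs hgf hgL =>
      (cheeger_half_support hY hc h hg hg0 hgs
        (ne_top_of_le_ne_top hfm (localNorm_mono hgf))).trans
        (mul_le_mul_right (Finset.sum_le_sum fun γ _ => localNorm_mono fun x => hgL _ _) 2)
  have hp := hhalf (fun x => max (f x - m) 0) ((hf.sub_const m).max measurable_const)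
    (fun x => le_max_right _ _) (by simpa using hm1)
    (fun x => by simp only [Real.norm_eq_abs]; grind)
    (fun x y => by simp only [Real.norm_eq_abs]; grind)
  have hn := hhalf (fun x => max (m - f x) 0) ((hf.const_sub m).max measurable_const)
    (fun x => le_max_right _ _) (by simpa using hm2)
    (fun x => by simp only [Real.norm_eq_abs]; grind)
    (fun x y => by simp only [Real.norm_eq_abs]; grind)
  have hsum : localNorm ν Y (fun x => f x - m) ≤
      localNorm ν Y (fun x => max (f x - m) 0) + localNorm ν Y (fun x => max (m - f x) 0) := by
    have e : (fun x => f x - m) = (fun x => max (f x - m) 0) - fun x => max (m - f x) 0 := by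
      ext x; simp only [Pi.sub_apply]; grind
    conv_lhs => rw [e]
    exact eLpNorm_sub_le ((hf.sub_const m).max measurable_const).aestronglyMeasurable
      ((hf.const_sub m).max measurable_const).aestronglyMeasurable (by simp)
  calc c * localNorm ν Y f ≤ c * localNorm ν Y (fun x => f x - m) :=
        mul_le_mul_right (eLpNorm_two_le_sub_const (hf2.restrict Y) h0 m) c
    _ ≤ c * (localNorm ν Y (fun x => max (f x - m) 0) +
        localNorm ν Y (fun x => max (m - f x) 0)) := mul_le_mul_right hsum c
    _ ≤ _ := by
      rw [mul_add]
      refine (add_le_add hp hn).trans_eq ?_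
      rw [← add_mul]
      norm_num

theorem cheeger_real (hY : MeasurableSet Y) (htop : ν Y ≠ ∞) (hc : c ≠ ∞)
    (h : ∀ A ⊆ Y, MeasurableSet A → ν A ≤ ν Y / 2 → c * ν A ≤ ∑ γ ∈ B, ν ((γ • A ∩ Y) \ A))
    {f : X → ℝ} (hf2 : MemLp f 2 ν) (h0 : ∫ x in Y, f x ∂ν = 0) :
    c * localNorm ν Y f ≤ 4 * ∑ γ ∈ B, localNorm ν Y (fun x => f (γ⁻¹ • x) - f x) := by
  have hae := hf2.1.ae_eq_mk
  rw [integral_congr_ae (ae_restrict_of_ae hae)] at h0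
  have key := cheeger_of_measurable hY htop hc h hf2.1.stronglyMeasurable_mk.measurable
    ((memLp_congr_ae hae).1 hf2) h0
  simp_rw [localNorm_smul_sub_congr (Y := Y) hae]
  rwa [show localNorm ν Y f = _ from eLpNorm_congr_ae (ae_restrict_of_ae hae)]

/-- Cheeger's inequality: expansion on `Y` bounds the local norm of functions of mean zero. -/
theorem cheeger {𝕜 : Type*} [RCLike 𝕜] (hY : MeasurableSet Y) (htop : ν Y ≠ ∞) (hc : c ≠ ∞)
    (h : ∀ A ⊆ Y, MeasurableSet A → ν A ≤ ν Y / 2 → c * ν A ≤ ∑ γ ∈ B, ν ((γ • A ∩ Y) \ A))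
    {f : X → 𝕜} (hf2 : MemLp f 2 ν) (h0 : ∫ x in Y, f x ∂ν = 0) :
    c * localNorm ν Y f ≤ 8 * ∑ γ ∈ B, localNorm ν Y (fun x => f (γ⁻¹ • x) - f x) := by
  have : IsFiniteMeasure (ν.restrict Y) := isFiniteMeasure_restrict.2 htop
  have hfi : Integrable f (ν.restrict Y) := (hf2.restrict Y).integrable (by norm_num)
  have hre := cheeger_real hY htop hc h hf2.re (by
    have := integral_re hfi
    rw [h0, map_zero] at this
    exact this)
  have him := cheeger_real hY htop hc h hf2.im (by
    have := integral_im hfi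
    rw [h0, map_zero] at this
    exact this)
  have hre' : ∀ γ ∈ B, localNorm ν Y (fun x => RCLike.re (f (γ⁻¹ • x)) - RCLike.re (f x)) ≤
      localNorm ν Y (fun x => f (γ⁻¹ • x) - f x) := fun γ _ => localNorm_mono fun x => by
    rw [← map_sub]; exact RCLike.norm_re_le_norm _
  have him' : ∀ γ ∈ B, localNorm ν Y (fun x => RCLike.im (f (γ⁻¹ • x)) - RCLike.im (f x)) ≤
      localNorm ν Y (fun x => f (γ⁻¹ • x) - f x) := fun γ _ => localNorm_mono fun x => by
    rw [← map_sub]; exact RCLike.norm_im_le_norm _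
  have hsum : localNorm ν Y f ≤
      localNorm ν Y (fun x => RCLike.re (f x)) + localNorm ν Y (fun x => RCLike.im (f x)) := by
    have e : localNorm ν Y f ≤ eLpNorm ((fun x => ‖RCLike.re (f x)‖) + fun x => ‖RCLike.im (f x)‖)
        2 (ν.restrict Y) := by
      refine eLpNorm_mono_real fun x => ?_
      simp only [Pi.add_apply, Real.norm_eq_abs]
      refine (sq_le_sq₀ (norm_nonneg _) (by positivity)).1 ?_
      rw [RCLike.norm_sq_eq_def, add_sq, sq_abs, sq_abs]
      have : 0 ≤ |RCLike.re (f x)| * |RCLike.im (f x)| := by positivity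
      linarith
    refine e.trans ((eLpNorm_add_le (hf2.re.1.norm.restrict) (hf2.im.1.norm.restrict)
      (by simp)).trans_eq ?_)
    rw [eLpNorm_norm, eLpNorm_norm]
    rfl
  calc c * localNorm ν Y f
      ≤ c * (localNorm ν Y (fun x => RCLike.re (f x)) + localNorm ν Y (fun x => RCLike.im (f x))) :=
        mul_le_mul_right hsum c
    _ ≤ 4 * ∑ γ ∈ B, localNorm ν Y (fun x => f (γ⁻¹ • x) - f x) +
        4 * ∑ γ ∈ B, localNorm ν Y (fun x => f (γ⁻¹ • x) - f x) := by
      rw [mul_add]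
      exact add_le_add (hre.trans (mul_le_mul_right (Finset.sum_le_sum hre') 4))
        (him.trans (mul_le_mul_right (Finset.sum_le_sum him') 4))
    _ = _ := by rw [← add_mul]; norm_num

end

/-! ### The equivalence -/

theorem mainTheorem4 (𝕜 : Type*) [RCLike 𝕜] {Γ X : Type*} [Group Γ] [Countable Γ]
    (ℓ : ProperLength Γ) [MeasurableSpace X] [MulAction Γ X] [MeasurableConstSMul Γ X]
    (ν : Measure X) [SigmaFinite ν] [ErgodicSMul Γ X ν] :
    IsStronglyErgodic Γ ν ↔
      ∃ Y : Set X, MeasurableSet Y ∧ 0 < ν Y ∧ ν Y < ∞ ∧ HasLocalSpectralGap 𝕜 ℓ ν Y := by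
  constructor
  · intro hse
    have hν : ν Set.univ ≠ 0 := fun h => by
      obtain ⟨ν', _, hac, -, -⟩ := hse
      exact one_ne_zero ((measure_univ (μ := ν')).symm.trans (hac h))
    obtain ⟨Y₀, hY₀, -, h0, htop⟩ := Measure.exists_subset_measure_lt_top
      (μ := ν) MeasurableSet.univ hν.bot_lt
    obtain ⟨k, δ, hδ, hexp⟩ := hse.exists_expansion ℓ hY₀ h0.ne' htop.ne (α := ν Y₀ / 4)
      (ENNReal.div_pos h0.ne' (by simp)).ne'
    obtain ⟨Y, hYY₀, hY, hY0, c, hc0, hc, hexp'⟩ :=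
      exists_subset_expansion hY₀ h0.ne' htop.ne hδ hexp
    have hYtop : ν Y < ∞ := (measure_mono hYY₀).trans_lt htop
    have hκ : 8 / c ≠ ∞ := ENNReal.div_ne_top (by simp) hc0
    -- `κ = 8 / c`: a factor 2 from Cheeger, doubled for positive and negative parts and again for
    -- real and imaginary parts.
    refine ⟨Y, hY, hY0.bot_lt, hYtop, (8 / c).toReal, ENNReal.toReal_pos
      (ENNReal.div_pos (by simp) hc).ne' hκ, k, fun f hf hf0 => ?_⟩
    have := cheeger hY hYtop.ne hc hexp' hf hf0
    rw [ENNReal.ofReal_toReal hκ, ← ENNReal.mul_le_mul_iff_right hc0 hc, ← mul_assoc,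
      ENNReal.mul_div_cancel hc0 hc]
    exact this
  · rintro ⟨Y, hY, h0, htop, hgap⟩
    exact hgap.isStronglyErgodic hY h0.ne' htop.ne
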